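/- **Proposition 5.2 (edge doubling).** Let $k$ be a field and let $K_0(\mathcal V)$ be the Grothendieck ring of varieties over $k$: the commutative ring generated by the isomorphism classes $[X]$ of varieties over $k$ (separated schemes of finite type over $k$), with the relations $[X]=[Z]+[X\smallsetminus Z]$ for $Z\subseteq X$ closed, $[X\times_k Y]=[X]\,[Y]$ and $[\operatorname{Spec} k]=1$. Let $\mathbb T=[\mathbb G_m]\in K_0(\mathcal V)$ be the class of the multiplicative group $\mathbb G_m=\operatorname{Spec} k[t,t^{-1}]$. For a finite graph $\Gamma$ (looping edges and parallel edges are allowed, and $\Gamma$ need not be connected) with $n$ edges, let $$\Psi_\Gamma(t)=\sum_{F}\ \prod_{f\notin F} t_f,$$ where the sum is over the edge sets $F$ of the spanning forests of $\Gamma$ (forests containing all vertices of $\Gamma$ and having the same connected components as $\Gamma$; these are the spanning trees if $\Gamma$ is connected) and the product is over the edges $f$ of $\Gamma$ that are not in $F$. Put $$\mathbb U(\Gamma)=[\mathbb A^n\smallsetminus \widehat X_\Gamma]\in K_0(\mathcal V),\qquad \widehat X_\Gamma=\{t\in\mathbb A^n : \Psi_\Gamma(t)=0\}.$$ Let $e$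 be an edge of $\Gamma$. Denote by $\Gamma\smallsetminus e$ and $\Gamma/e$ the deletion and the contraction of $e$, and by $\Gamma_{2e}$ the graph obtained from $\Gamma$ by replacing $e$ by two parallel edges with the same ends. Call $e$ a looping edge if its two ends coincide, and a bridge if its removal increases the number of connected components. - If $e$ is a looping edge, then $\mathbb U(\Gamma_{2e})=\mathbb T^2\,\mathbb U(\Gamma\smallsetminus e)$. - If $e$ is a bridge, then $\mathbb U(\Gamma_{2e})=\mathbb T(\mathbb T+1)\,\mathbb U(\Gamma\smallsetminus e)$. - If $e$ is neither a looping edge nor a bridge, then $$\mathbb U(\Gamma_{2e})=(\mathbb T-1)\,\mathbb U(\Gamma)+\mathbb T\,\mathbb U(\Gamma\smallsetminus e)+(\mathbb T+1)\,\mathbb U(\Gamma/e).$$ -/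

import Mathlib

open CategoryTheory AlgebraicGeometry

universe u v

noncomputable section

/-! ### Finite multigraphs: bridges, spanning forests, contraction, doubling of an edge -/

namespace Graph

variable {α : Type v} {β : Type u}

/-- Two vertices are joined by a (possibly trivial) path in `G`. -/
def PathConnected (G : Graph α β) (x y : α) : Prop :=
  Relation.ReflTransGen G.Adj x y

/-- A looping edge: an edge that starts and ends at the same vertex. -/
def IsLoopingEdge (G : Graph α β) (e : β) : Prop :=
  ∃ x, G.IsLink e x x

/-- A bridge: an edge whose removal disconnects two vertices which were connected in `G`,
i.e. whose removal increases the number of connected components. -/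
def IsBridge (G : Graph α β) (e : β) : Prop :=
  e ∈ G.edgeSet ∧ ∃ x y, G.PathConnected x y ∧ ¬ (G.deleteEdges {e}).PathConnected x y

/-- A forest (a graph without cycles): every edge is a bridge. -/
def IsForest (G : Graph α β) : Prop :=
  ∀ e ∈ G.edgeSet, G.IsBridge e

/-- `F` is the edge set of a spanning forest of `G`: the subgraph with all the vertices of `G`
and with edge set `F` is a forest having the same connected components as `G`. For connected `G`
these are the spanning trees. -/
def IsSpanningForest (G : Graph α β) (F : Set β) : Prop :=
  F ⊆ G.edgeSet ∧ (G.restrict F).IsForest ∧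
    ∀ x y, (G.restrict F).PathConnected x y ↔ G.PathConnected x y

/-- The contraction `G / e`: the end-vertices of `e` are identified and `e` is removed.
The vertices live in the quotient of `α` by the equivalence relation generated by the relation
"`e` links `x` and `y`". -/
def contractEdge (G : Graph α β) (e : β) : Graph (Quot (G.IsLink e)) β :=
  (G.map (Quot.mk (G.IsLink e))).deleteEdges {e}

/-- The graph `G_{2e}`: the edge `e` is replaced by two parallel edges with the same ends.
The edges of `G` are kept as `some f`, and `none` is the additional edge parallel to `e`. -/
def doubleEdge (G : Graph α β) (e : β) : Graph α (Option β) where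
  vertexSet := G.vertexSet
  IsLink f x y := G.IsLink (f.getD e) x y
  edgeSet := {f | f.getD e ∈ G.edgeSet}
  isLink_symm _ he := G.isLink_symm he
  eq_or_eq_of_isLink_of_isLink _ _ _ _ _ h h' := G.eq_or_eq_of_isLink_of_isLink h h'
  edge_mem_iff_exists_isLink f := G.edge_mem_iff_exists_isLink (f.getD e)
  left_mem_of_isLink _ _ _ h := G.left_mem_of_isLink h

instance finite_edgeSet_deleteEdges (G : Graph α β) [Finite G.edgeSet] (F : Set β) :
    Finite (G.deleteEdges F).edgeSet :=
  Finite.Set.subset G.edgeSet (IsSubgraph.edgeSet_mono deleteEdges_le)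

instance finite_edgeSet_contractEdge (G : Graph α β) [Finite G.edgeSet] (e : β) :
    Finite (G.contractEdge e).edgeSet :=
  have : Finite (G.map (Quot.mk (G.IsLink e))).edgeSet := ‹Finite G.edgeSet›
  finite_edgeSet_deleteEdges _ _

instance finite_edgeSet_doubleEdge (G : Graph α β) [Finite G.edgeSet] (e : β) :
    Finite (G.doubleEdge e).edgeSet := by
  refine Set.Finite.subset (s := insert none (some '' G.edgeSet))
    (((Set.toFinite G.edgeSet).image some).insert none) ?_
  rintro (_ | f) hf
  · exact Set.mem_insert _ _
  · exact Set.mem_insert_of_mem _ ⟨f, hf, rfl⟩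

open Classical in
/-- The Kirchhoff polynomial `Ψ_G = ∑_F ∏_{e ∉ F} t_e`, the sum running over the spanning forests
`F` of `G` (spanning trees if `G` is connected), with one variable for each edge of `G`. -/
def kirchhoffPolynomial (R : Type u) [CommRing R] (G : Graph α β) [Finite G.edgeSet] :
    MvPolynomial G.edgeSet R :=
  letI := Fintype.ofFinite G.edgeSet
  ∑ F : {F : Finset G.edgeSet // G.IsSpanningForest (Subtype.val '' (F : Set G.edgeSet))},
    ∏ e ∈ F.valᶜ, MvPolynomial.X e

end Graph

/-! ### Varieties over a field and their Grothendieck ring -/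

/-- Varieties over the field `k`: separated schemes of finite type over `k`. They need not be
reduced, but `X` and its reduction have the same class in the Grothendieck ring, because the
reduction is a closed subscheme of `X` with empty complement. -/
structure AlgVariety (k : Type u) [Field k] where
  /-- The underlying scheme. -/
  carrier : Scheme.{u}
  /-- The structure morphism. -/
  str : carrier ⟶ Spec (CommRingCat.of k)
  [isSeparated : IsSeparated str]
  [locallyOfFiniteType : LocallyOfFiniteType str]
  [quasiCompact : QuasiCompact str]

namespace AlgVariety

attribute [instance] isSeparated locallyOfFiniteType quasiCompact

variable (k : Type u) [Field k]

/-- The affine variety `Spec A` of a finitely generated `k`-algebra `A`. -/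
def affine (A : Type u) [CommRing A] [Algebra k A] [Algebra.FiniteType k A] : AlgVariety k where
  carrier := Spec (CommRingCat.of A)
  str := Spec.map (CommRingCat.ofHom (algebraMap k A))
  locallyOfFiniteType := by
    rw [HasRingHomProperty.Spec_iff (P := @LocallyOfFiniteType)]
    exact (RingHom.finiteType_algebraMap).mpr ‹_›

variable {k}

/-- An open subscheme of a variety, as a variety. -/
def openSubscheme (X : AlgVariety k) (U : X.carrier.Opens) : AlgVariety k where
  carrier := U
  str := U.ι ≫ X.str
  quasiCompact := by
    have : IsLocallyNoetherian X.carrier := LocallyOfFiniteType.isLocallyNoetherian X.str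
    infer_instance

end AlgVariety

namespace GrothendieckRing

variable (k : Type u) [Field k]

/-- The defining relations of the Grothendieck ring of varieties, as elements of the polynomial
ring (the free commutative ring) on the varieties over `k`. -/
inductive IsRelation : MvPolynomial (AlgVariety k) ℤ → Prop
  /-- Isomorphic varieties have the same class. -/
  | iso (X Y : AlgVariety k) (f : X.carrier ≅ Y.carrier) (hf : f.hom ≫ Y.str = X.str) :
      IsRelation (MvPolynomial.X X - MvPolynomial.X Y)
  /-- `[X] = [Z] + [U]` if `Z` is a closed subvariety of `X` with open complement `U`. -/
  | scissors (X Z U : AlgVariety k) (i : Z.carrier ⟶ X.carrier) (j : U.carrier ⟶ X.carrier)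
      (hi : IsClosedImmersion i) (hj : IsOpenImmersion j)
      (hiX : i ≫ X.str = Z.str) (hjX : j ≫ X.str = U.str)
      (hij : Set.range j = (Set.range i)ᶜ) :
      IsRelation (MvPolynomial.X X - (MvPolynomial.X Z + MvPolynomial.X U))
  /-- `[X ×_k Y] = [X] [Y]`. -/
  | prod (X Y P : AlgVariety k) (p : P.carrier ⟶ X.carrier) (q : P.carrier ⟶ Y.carrier)
      (h : IsPullback p q X.str Y.str) (hp : p ≫ X.str = P.str) :
      IsRelation (MvPolynomial.X P - MvPolynomial.X X * MvPolynomial.X Y)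
  /-- `[Spec k] = 1`. -/
  | one : IsRelation (MvPolynomial.X (AlgVariety.affine k k) - 1)

end GrothendieckRing

/-- The Grothendieck ring `K₀(𝒱_k)` of varieties over `k`: the commutative ring generated by the
isomorphism classes of varieties over `k`, with the relations `[X] = [Z] + [X ∖ Z]` for `Z` closed
in `X`, `[X ×_k Y] = [X] [Y]` and `[Spec k] = 1`. -/
abbrev GrothendieckRing (k : Type u) [Field k] : Type (u + 1) :=
  MvPolynomial (AlgVariety k) ℤ ⧸ Ideal.span {p | GrothendieckRing.IsRelation k p}

/-- The class `[X]` of a variety in the Grothendieck ring. -/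
def AlgVariety.cls {k : Type u} [Field k] (X : AlgVariety k) : GrothendieckRing k :=
  Ideal.Quotient.mk _ (MvPolynomial.X X)

/-- `𝕋 = [𝔾_m]`, the class of the multiplicative group `𝔾_m = Spec k[t, t⁻¹]`. -/
def torusClass (k : Type u) [Field k] : GrothendieckRing k :=
  (AlgVariety.affine k (LaurentPolynomial k)).cls

/-- The affine space over `k` with one coordinate for each element of the finite type `ι`. -/
def affineSpaceVariety (k : Type u) [Field k] (ι : Type u) [Finite ι] : AlgVariety k :=
  AlgVariety.affine k (MvPolynomial ι k)

/-- The complement `𝔸^n ∖ {Ψ = 0}` of the affine hypersurface defined by a polynomial `Ψ`, an open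
subscheme of affine space. -/
def hypersurfaceComplement {k : Type u} [Field k] {ι : Type u} [Finite ι]
    (Ψ : MvPolynomial ι k) : AlgVariety k :=
  (affineSpaceVariety k ι).openSubscheme
    ⟨(PrimeSpectrum.zeroLocus {Ψ})ᶜ, (PrimeSpectrum.isClosed_zeroLocus {Ψ}).isOpen_compl⟩

/-- The universal motivic Feynman rule `𝕌(G) = [𝔸^n ∖ X̂_G]`, the class in `K₀(𝒱_k)` of the
complement of the affine graph hypersurface `X̂_G = {Ψ_G = 0} ⊆ 𝔸^n`, `n` the number of edges. -/
def motivicFeynmanRule (k : Type u) [Field k] {α : Type v} {β : Type u} (G : Graph α β)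
    [Finite G.edgeSet] : GrothendieckRing k :=
  (hypersurfaceComplement (G.kirchhoffPolynomial k)).cls

end

/-! Write `t` for the variable of `e`. Sorting the spanning forests of `G` by whether they contain
`e` gives `Ψ_G = t A + C`, where `A` and `C` do not involve `t`. A spanning forest of the doubled
graph contains at most one copy of `e`, so with `s` the variable of the new edge its polynomial is
`s Ψ_G + t C`.

For functions `p`, `q` on an affine variety, the complement of `s p + q = 0` in the line over it is
a punctured line where `p` is invertible, and a full line where `p = 0` and `q` is invertible
(`pieceClass_linear`). With `p = Ψ_G` and `q = t C`, the second base is given by `t A + C = 0` with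
`t C` invertible. There `t A = -C` is invertible, so `A` is too, and `t = -C / A` is determined:
this base is the locus `A C ≠ 0` (`pieceClass_graph_mul`). Hence `𝕌(G_{2e}) = 𝕋 𝕌(G) + (𝕋 + 1) [A C
≠ 0]`.

It remains to identify `A` and `C`. For a looping edge `C = 0` and `A = Ψ_{G∖e}`; for a bridge `A =
0` and `C = Ψ_{G∖e}`; otherwise `A = Ψ_{G∖e}` and `C = Ψ_{G/e}`. In the last case `[A C ≠ 0]` is
eliminated using `[C ≠ 0] = [A C ≠ 0] + [A = 0, C ≠ 0]` and the formula for `𝕌(G)` coming from `Ψ_G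
= t A + C`. -/

namespace Graph

/-! ### Spanning forests under deletion and contraction of an edge -/

section Joined

variable {α : Type*} {β : Type*} {G : Graph α β} {F F' : Set β} {e f : β} {u v x y z : α}

/-- Two vertices are joined by a (possibly trivial) path of `G` with all edges in `F`. -/
def JoinedBy (G : Graph α β) (F : Set β) (x y : α) : Prop :=
  Relation.ReflTransGen (fun a b => ∃ f ∈ F, G.IsLink f a b) x y

namespace JoinedBy

theorem refl (G : Graph α β) (F : Set β) (x : α) : G.JoinedBy F x x :=
  Relation.ReflTransGen.refl

theorem trans (h : G.JoinedBy F x y) (h' : G.JoinedBy F y z) : G.JoinedBy F x z :=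
  Relation.ReflTransGen.trans h h'

theorem of_isLink (hf : f ∈ F) (h : G.IsLink f x y) : G.JoinedBy F x y :=
  Relation.ReflTransGen.single ⟨f, hf, h⟩

theorem symm (h : G.JoinedBy F x y) : G.JoinedBy F y x := by
  induction h with
  | refl => exact refl G F x
  | tail _ h ih =>
    obtain ⟨f, hf, h⟩ := h
    exact (of_isLink hf h.symm).trans ih

/-- A map of vertices along which the links of `F` become paths in `F'` preserves paths. -/
theorem lift {α' β' : Type*} {G' : Graph α' β'} {F' : Set β'} (q : α → α')
    (hq : ∀ f ∈ F, ∀ a b, G.IsLink f a b → G'.JoinedBy F' (q a) (q b)) (h : G.JoinedBy F x y) :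
    G'.JoinedBy F' (q x) (q y) := by
  induction h with
  | refl => exact refl G' F' (q x)
  | tail _ h ih =>
    obtain ⟨f, hf, h⟩ := h
    exact ih.trans (hq f hf _ _ h)

theorem mono (hF : F ⊆ F') (h : G.JoinedBy F x y) : G.JoinedBy F' x y :=
  h.lift id fun _ hf _ _ hl => of_isLink (hF hf) hl

/-- A path that may use the edge `e` either avoids it, or splits into paths from its ends to the
ends of `e`. -/
theorem of_insert (he : G.IsLink e u v) (h : G.JoinedBy (insert e F) x y) :
    G.JoinedBy F x y ∨ (G.JoinedBy F x u ∧ G.JoinedBy F v y) ∨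
      (G.JoinedBy F x v ∧ G.JoinedBy F u y) := by
  induction h with
  | refl => exact .inl (refl G F x)
  | tail _ h ih =>
    obtain ⟨f, rfl | hf, h⟩ := h
    · obtain ⟨rfl, rfl⟩ | ⟨rfl, rfl⟩ := h.eq_and_eq_or_eq_and_eq he
      · rcases ih with h | ⟨h, -⟩ | ⟨h, -⟩
        · exact .inr (.inl ⟨h, refl ..⟩)
        · exact .inr (.inl ⟨h, refl ..⟩)
        · exact .inl h
      · rcases ih with h | ⟨h, -⟩ | ⟨h, -⟩
        · exact .inr (.inr ⟨h, refl ..⟩)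
        · exact .inl h
        · exact .inr (.inr ⟨h, refl ..⟩)
    · have hl := of_isLink hf h
      exact ih.imp (·.trans hl) (Or.imp (fun h => ⟨h.1, h.2.trans hl⟩) fun h => ⟨h.1, h.2.trans hl⟩)

/-- If two vertices are joined by a path through `f` but not by one avoiding `f`, then the ends
of `f` become joined without `f` as soon as the two vertices do. -/
theorem exchange (hf : G.IsLink f x y) (h : G.JoinedBy (insert f F) u v)
    (hn : ¬ G.JoinedBy F u v) (hFF' : F ⊆ F') (h' : G.JoinedBy F' u v) : G.JoinedBy F' x y := by
  rcases h.of_insert hf with h | ⟨h₁, h₂⟩ | ⟨h₁, h₂⟩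
  · exact absurd h hn
  · exact (h₁.symm.mono hFF').trans (h'.trans (h₂.symm.mono hFF'))
  · exact (h₂.mono hFF').trans (h'.symm.trans (h₁.mono hFF'))

end JoinedBy

/-- Links to the definitions a formalism in which the graph stays fixed and only the set of allowed
edges varies, so that nested restrictions and deletions become set operations. -/
theorem pathConnected_restrict : (G.restrict F).PathConnected x y ↔ G.JoinedBy F x y :=
  Iff.rfl

theorem pathConnected_iff : G.PathConnected x y ↔ G.JoinedBy G.edgeSet x y := by
  rw [← pathConnected_restrict, restrict_self]

theorem pathConnected_deleteEdges :
    (G.deleteEdges F).PathConnected x y ↔ G.JoinedBy (G.edgeSet \ F) x y := by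
  rw [← restrict_edgeSet_sdiff_eq_deleteEdges, pathConnected_restrict]

theorem restrict_deleteEdges : (G.restrict F).deleteEdges F' = G.restrict (F \ F') := by
  rw [← restrict_edgeSet_sdiff_eq_deleteEdges, restrict_restrict, edgeSet_restrict,
    ← restrict_inter_edgeSet G (F \ F')]
  congr 1
  grind

/-- A detour between the ends of `e` replaces every passage through `e`, so only these two vertices
need to be tested. -/
theorem isBridge_iff_of_isLink (he : G.IsLink e u v) :
    G.IsBridge e ↔ ¬ G.JoinedBy (G.edgeSet \ {e}) u v := by
  refine ⟨?_, fun h => ⟨he.edge_mem, u, v, pathConnected_iff.2 (.of_isLink he.edge_mem he), ?_⟩⟩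
  · rintro ⟨-, x, y, h, hn⟩ h'
    rw [pathConnected_deleteEdges] at hn
    refine hn ((pathConnected_iff.1 h).lift id fun f hf a b hl => ?_)
    by_cases hfe : f = e
    · subst hfe
      obtain ⟨rfl, rfl⟩ | ⟨rfl, rfl⟩ := hl.eq_and_eq_or_eq_and_eq he
      exacts [h', h'.symm]
    · exact .of_isLink ⟨hf, hfe⟩ hl
  · rwa [pathConnected_deleteEdges]

/-- Spanning forests in terms of the ends of the edges. -/
theorem isSpanningForest_iff : G.IsSpanningForest F ↔ F ⊆ G.edgeSet ∧
    (∀ f ∈ F, ∀ u v, G.IsLink f u v → ¬ G.JoinedBy (F \ {f}) u v) ∧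
    ∀ f ∈ G.edgeSet, ∀ u v, G.IsLink f u v → G.JoinedBy F u v := by
  refine and_congr_right fun hF => and_congr ?_ ?_
  · have key : ∀ f ∈ F, ∀ u v, G.IsLink f u v →
        ((G.restrict F).IsBridge f ↔ ¬ G.JoinedBy (F \ {f}) u v) := by
      intro f hf u v h
      rw [isBridge_iff_of_isLink (G := G.restrict F) ⟨hf, h⟩, ← pathConnected_deleteEdges,
        restrict_deleteEdges, pathConnected_restrict]
    constructor
    · intro h f hf u v hl
      exact (key f hf u v hl).1 (h f ⟨hF hf, hf⟩)
    · intro h f hf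
      obtain ⟨u, v, hl⟩ := exists_isLink_of_mem_edgeSet hf.1
      exact (key f hf.2 u v hl).2 (h f hf.2 u v hl)
  · simp only [pathConnected_restrict, pathConnected_iff (G := G)]
    exact ⟨fun h f hf u v hl => (h u v).2 (.of_isLink hf hl),
      fun h x y => ⟨.mono hF, .lift id h⟩⟩

theorem IsLoopingEdge.notMem_of_isSpanningForest (he : G.IsLoopingEdge e)
    (hF : G.IsSpanningForest F) : e ∉ F := by
  obtain ⟨x, hx⟩ := he
  exact fun h => (isSpanningForest_iff.1 hF).2.1 e h x x hx (.refl ..)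

theorem IsBridge.mem_of_isSpanningForest (he : G.IsBridge e) (hF : G.IsSpanningForest F) :
    e ∈ F := by
  obtain ⟨u, v, hl⟩ := exists_isLink_of_mem_edgeSet he.1
  rw [isSpanningForest_iff] at hF
  by_contra h
  refine (isBridge_iff_of_isLink hl).1 he ((hF.2.2 e he.1 u v hl).mono fun f hf => ⟨hF.1 hf, ?_⟩)
  rintro rfl
  exact h hf

theorem joinedBy_deleteEdges :
    (G.deleteEdges F').JoinedBy F x y ↔ G.JoinedBy (F \ F') x y := by
  rw [← pathConnected_restrict, ← pathConnected_restrict]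
  have : (G.deleteEdges F').restrict F = G.restrict (F \ F') := by
    rw [← restrict_edgeSet_sdiff_eq_deleteEdges, restrict_restrict, ← restrict_edgeSet_inter]
    nth_rw 2 [← restrict_edgeSet_inter]
    congr 1
    grind
  rw [this]

theorem isSpanningForest_deleteEdges_iff : (G.deleteEdges F').IsSpanningForest F ↔
    F ⊆ G.edgeSet \ F' ∧
    (∀ f ∈ F, ∀ u v, G.IsLink f u v → ¬ G.JoinedBy (F \ {f}) u v) ∧
    ∀ f ∈ G.edgeSet \ F', ∀ u v, G.IsLink f u v → G.JoinedBy F u v := by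
  rw [isSpanningForest_iff]
  refine and_congr_right fun hF => ?_
  have hF' : F \ F' = F := by
    ext f
    exact ⟨And.left, fun h => ⟨h, (hF h).2⟩⟩
  have h1 : ∀ f, (F \ {f}) \ F' = F \ {f} := fun f => by rw [sdiff_right_comm, hF']
  simp only [joinedBy_deleteEdges, hF', h1, deleteEdges_isLink]
  refine and_congr ?_ ?_
  · exact ⟨fun h f hf u v hl => h f hf u v ⟨hl, (hF hf).2⟩, fun h f hf u v hl => h f hf u v hl.1⟩
  · exact ⟨fun h f hf u v hl => h f hf u v ⟨hl, hf.2⟩, fun h f hf u v hl => h f hf u v hl.1⟩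

/-- Only the spanning condition at `e` differs. Since `e` is not a bridge, its ends are joined by
other edges, and `F` joins the ends of each of those. -/
theorem isSpanningForest_deleteEdges_of_not_isBridge (he : e ∈ G.edgeSet) (hb : ¬ G.IsBridge e)
    (heF : e ∉ F) : (G.deleteEdges {e}).IsSpanningForest F ↔ G.IsSpanningForest F := by
  obtain ⟨u, v, hl⟩ := exists_isLink_of_mem_edgeSet he
  rw [isBridge_iff_of_isLink hl, not_not] at hb
  rw [isSpanningForest_deleteEdges_iff, isSpanningForest_iff]
  refine and_congr ?_ (and_congr_right fun _ => ?_)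
  · exact ⟨fun h f hf => (h hf).1, fun h f hf => ⟨h hf, by rintro rfl; exact heF hf⟩⟩
  · refine ⟨fun h f hf a b hf' => ?_, fun h f hf => h f hf.1⟩
    by_cases hfe : f = e
    · subst hfe
      have := hb.lift (F' := F) id h
      obtain ⟨rfl, rfl⟩ | ⟨rfl, rfl⟩ := hf'.eq_and_eq_or_eq_and_eq hl
      exacts [this, this.symm]
    · exact h f ⟨hf, hfe⟩ a b hf'

/-- A bridge lies on no cycle: whenever a path needs `e` although its end-vertices are also joined
by edges other than `e`, `JoinedBy.exchange` joins the ends of `e` without `e`. -/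
theorem isSpanningForest_deleteEdges_of_isBridge (hb : G.IsBridge e) (heF : e ∉ F) :
    (G.deleteEdges {e}).IsSpanningForest F ↔ G.IsSpanningForest (insert e F) := by
  have he := hb.1
  obtain ⟨u, v, hl⟩ := exists_isLink_of_mem_edgeSet he
  rw [isBridge_iff_of_isLink hl] at hb
  have hFe : insert e F \ {e} = F := Set.insert_sdiff_self_of_notMem heF
  have hins : ∀ f ∈ F, insert e F \ {f} = insert e (F \ {f}) := fun f hf =>
    Set.insert_sdiff_of_notMem _ (by rintro rfl; exact heF hf)
  rw [isSpanningForest_deleteEdges_iff, isSpanningForest_iff]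
  constructor
  · rintro ⟨hF, hforest, hspan⟩
    refine ⟨Set.insert_subset he fun f hf => (hF hf).1, ?_, ?_⟩
    · rintro f (rfl | hf) a b hf' hj
      · rw [hFe] at hj
        have := hj.mono hF
        obtain ⟨rfl, rfl⟩ | ⟨rfl, rfl⟩ := hf'.eq_and_eq_or_eq_and_eq hl
        exacts [hb this, hb this.symm]
      · rw [hins f hf] at hj
        exact hb (.exchange hl hj (hforest f hf a b hf')
          (Set.sdiff_subset.trans hF) (.of_isLink (hF hf) hf'))
    · intro f hf a b hf'
      by_cases hfe : f = e
      · subst hfe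
        exact .of_isLink (Set.mem_insert ..) hf'
      · exact (hspan f ⟨hf, hfe⟩ a b hf').mono (Set.subset_insert ..)
  · rintro ⟨hF, hforest, hspan⟩
    have hF' : F ⊆ G.edgeSet \ {e} := fun f hf =>
      ⟨hF (.inr hf), by rintro rfl; exact heF hf⟩
    refine ⟨hF', fun f hf a b hf' hj => ?_, fun f hf a b hf' => ?_⟩
    · refine hforest f (.inr hf) a b hf' (hj.mono ?_)
      exact Set.sdiff_subset_sdiff_left (Set.subset_insert ..)
    · by_contra hn
      exact hb (.exchange hl (hspan f hf.1 a b hf') hn hF' (.of_isLink hf hf'))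

/-- If `F` joins the ends `u ≠ v` of the edge `e`, then some edge of `F` lies on a cycle through
`e`: its ends are joined by `e` and the other edges of `F`. -/
theorem JoinedBy.exists_of_ne (hF : F.Finite) (huv : u ≠ v) (he : G.IsLink e u v)
    (h : G.JoinedBy F u v) :
    ∃ f ∈ F, ∃ a b, G.IsLink f a b ∧ G.JoinedBy (insert e (F \ {f})) a b := by
  induction F, hF using Set.Finite.induction_on_subset with
  | empty =>
    exfalso
    rcases Relation.ReflTransGen.cases_head h with h | ⟨c, ⟨f, hf, -⟩, -⟩
    exacts [huv h, hf]
  | @insert f S _ _ hfS ih =>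
    -- If `S` already joins `u` and `v`, induction applies. Otherwise the new edge `f` is
    -- indispensable, and `e` closes a cycle through it.
    by_cases hS : G.JoinedBy S u v
    · obtain ⟨f', hf', a, b, hl, hj⟩ := ih hS
      refine ⟨f', .inr hf', a, b, hl, hj.mono ?_⟩
      gcongr
      exact Set.subset_insert ..
    -- `F` is not assumed to consist of edges of `G`; an element that links nothing cannot
    -- contribute to a path.
    · by_cases hex : ∃ a b, G.IsLink f a b
      · obtain ⟨a, b, hl⟩ := hex
        refine ⟨f, Set.mem_insert .., a, b, hl, ?_⟩
        rw [Set.insert_sdiff_self_of_notMem hfS]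
        exact .exchange hl h hS (Set.subset_insert ..) (.of_isLink (Set.mem_insert ..) he)
      · refine absurd (h.lift id fun f' hf' a b hl => ?_) hS
        rcases hf' with rfl | hf'
        · exact absurd ⟨a, b, hl⟩ hex
        · exact .of_isLink hf' hl

/-- Equality of classes in the quotient is generated by links along `e`, so a path in the
contraction lifts once steps along `e` are inserted. -/
theorem joinedBy_contractEdge (hl : G.IsLink e u v) (heF : e ∉ F) :
    (G.contractEdge e).JoinedBy F (Quot.mk _ x) (Quot.mk _ y) ↔ G.JoinedBy (insert e F) x y := by
  constructor
  · intro h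
    have step : ∀ a b, (Quot.mk (G.IsLink e) a) = Quot.mk _ b → G.JoinedBy (insert e F) a b := by
      intro a b hab
      replace hab := Quot.eqvGen_exact hab
      induction hab with
      | rel _ _ h => exact .of_isLink (Set.mem_insert ..) h
      | refl => exact .refl ..
      | symm _ _ _ ih => exact ih.symm
      | trans _ _ _ _ _ ih ih' => exact ih.trans ih'
    have : ∀ z : Quot (G.IsLink e), (G.contractEdge e).JoinedBy F (Quot.mk _ x) z →
        ∀ y, Quot.mk _ y = z → G.JoinedBy (insert e F) x y := by
      intro z h
      induction h with
      | refl => exact fun y hy => step _ _ hy.symm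
      | tail _ h ih =>
        rintro y rfl
        obtain ⟨f, hf, ⟨a, b, hab, rfl, hb⟩, -⟩ := h
        exact (ih a rfl).trans ((JoinedBy.of_isLink (.inr hf) hab).trans (step _ _ hb))
    exact this _ h y rfl
  · refine .lift _ ?_
    rintro f (rfl | hf) a b hab
    · rw [Quot.sound hab]
      exact .refl ..
    · exact .of_isLink hf ⟨hab.map _, by rintro rfl; exact heF hf⟩

/-- By `joinedBy_contractEdge` the conditions at edges other than `e` correspond directly. The
delicate point is that `F` must not join the ends of `e`: otherwise `JoinedBy.exists_of_ne` yields
an edge of `F` on a cycle through `e`, which remains a cycle after contraction. That the ends are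
distinct is where a looping edge is excluded. -/
theorem isSpanningForest_contractEdge [Finite G.edgeSet] (he : e ∈ G.edgeSet)
    (hloop : ¬ G.IsLoopingEdge e) (heF : e ∉ F) :
    (G.contractEdge e).IsSpanningForest F ↔ G.IsSpanningForest (insert e F) := by
  obtain ⟨u, v, hl⟩ := exists_isLink_of_mem_edgeSet he
  have huv : u ≠ v := by
    rintro rfl
    exact hloop ⟨u, hl⟩
  have hFe : insert e F \ {e} = F := Set.insert_sdiff_self_of_notMem heF
  have hins : ∀ f ∈ F, insert e F \ {f} = insert e (F \ {f}) := fun f hf =>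
    Set.insert_sdiff_of_notMem _ (by rintro rfl; exact heF hf)
  have hlink : ∀ f ∈ F, ∀ a b, G.IsLink f a b →
      (G.contractEdge e).IsLink f (Quot.mk _ a) (Quot.mk _ b) := fun f hf a b hab =>
    ⟨hab.map _, by rintro rfl; exact heF hf⟩
  rw [isSpanningForest_iff, isSpanningForest_iff]
  constructor
  · rintro ⟨hF, hforest, hspan⟩
    have hforest' : ∀ f ∈ F, ∀ a b, G.IsLink f a b → ¬ G.JoinedBy (insert e (F \ {f})) a b :=
      fun f hf a b hab hj => hforest f hf _ _ (hlink f hf a b hab)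
        ((joinedBy_contractEdge hl fun h => heF h.1).2 hj)
    refine ⟨Set.insert_subset he fun f hf => (hF hf).1, ?_, ?_⟩
    · rintro f (rfl | hf) a b hab hj
      · rw [hFe] at hj
        have hfin : F.Finite := (Set.toFinite G.edgeSet).subset fun f hf => (hF hf).1
        obtain ⟨f', hf', c, d, hcd, hj'⟩ := JoinedBy.exists_of_ne hfin
          (by rintro rfl; exact hloop ⟨_, hab⟩) hab hj
        exact hforest' f' hf' c d hcd hj'
      · rw [hins f hf] at hj
        exact hforest' f hf a b hab hj
    · intro f hf a b hab
      by_cases hfe : f = e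
      · subst hfe
        exact .of_isLink (Set.mem_insert ..) hab
      · exact (joinedBy_contractEdge hl heF).1 (hspan f ⟨hf, hfe⟩ _ _ ⟨hab.map _, hfe⟩)
  · rintro ⟨hF, hforest, hspan⟩
    refine ⟨fun f hf => ⟨hF (.inr hf), by rintro rfl; exact heF hf⟩, ?_, ?_⟩
    · rintro f hf - - ⟨⟨a, b, hab, rfl, rfl⟩, -⟩ hj
      rw [joinedBy_contractEdge hl fun h => heF h.1, ← hins f hf] at hj
      exact hforest f (.inr hf) a b hab hj
    · rintro f hf - - ⟨⟨a, b, hab, rfl, rfl⟩, -⟩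
      rw [joinedBy_contractEdge hl heF]
      exact hspan f hf.1 a b hab

end Joined

/-! ### Spanning forests after doubling an edge -/

section Double

variable {α : Type*} {β : Type u} {G : Graph α β} {e : β} {F : Set (Option β)} {x y : α}

theorem joinedBy_doubleEdge :
    (G.doubleEdge e).JoinedBy F x y ↔ G.JoinedBy ((·.getD e) '' F) x y := by
  constructor
  · exact .lift id fun f hf a b h => .of_isLink (Set.mem_image_of_mem _ hf) h
  · refine .lift id ?_
    rintro - ⟨f, hf, rfl⟩ a b h
    exact .of_isLink hf h

/-- The spanning forests of `G_{2e}` contain at most one of the two copies of `e`, and become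
spanning forests of `G` when the two copies are identified. -/
theorem isSpanningForest_doubleEdge (he : e ∈ G.edgeSet) :
    (G.doubleEdge e).IsSpanningForest F ↔
      ¬ (none ∈ F ∧ some e ∈ F) ∧ G.IsSpanningForest ((·.getD e) '' F) := by
  rw [isSpanningForest_iff, isSpanningForest_iff]
  simp only [joinedBy_doubleEdge]
  -- Identifying the two copies of `e` is injective on a set containing at most one of them, so it
  -- commutes with removing an element.
  have hdiff : ¬ (none ∈ F ∧ some e ∈ F) → ∀ f ∈ F,
      (fun x : Option β => x.getD e) '' (F \ {f}) = ((·.getD e) '' F) \ {f.getD e} := by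
    intro hn f hf
    ext b
    constructor
    · rintro ⟨f', ⟨hf', hne⟩, rfl⟩
      refine ⟨⟨f', hf', rfl⟩, fun h => hne ?_⟩
      rcases f with _ | f <;> rcases f' with _ | f' <;> simp_all
    · rintro ⟨⟨f', hf', rfl⟩, hne⟩
      exact ⟨f', ⟨hf', by rintro rfl; exact hne rfl⟩, rfl⟩
  constructor
  · rintro ⟨hF, hforest, hspan⟩
    have hn : ¬ (none ∈ F ∧ some e ∈ F) := by
      rintro ⟨h₁, h₂⟩
      obtain ⟨u, v, hl⟩ := exists_isLink_of_mem_edgeSet he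
      -- The two copies of `e` would form a cycle.
      exact hforest none h₁ u v hl (.of_isLink ⟨some e, ⟨h₂, by simp⟩, rfl⟩ hl)
    refine ⟨hn, ?_, ?_, fun f hf => hspan (some f) hf⟩
    · rintro - ⟨f, hf, rfl⟩
      exact hF hf
    · rintro - ⟨f, hf, rfl⟩ u v hl
      rw [← hdiff hn f hf]
      exact hforest f hf u v hl
  · rintro ⟨hn, hF, hforest, hspan⟩
    refine ⟨fun f hf => hF ⟨f, hf, rfl⟩, fun f hf u v hl => ?_, fun f hf => hspan _ hf⟩
    rw [hdiff hn f hf]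
    exact hforest _ ⟨f, hf, rfl⟩ u v hl

end Double

end Graph

/-! ### Squarefree polynomials indexed by families of subsets -/

section SubsetPolynomial

open MvPolynomial

open Classical in
/-- The monomial `∏_{i ∉ F} t_i` if `S F` holds, and `0` otherwise. -/
noncomputable def subsetMonomial (R : Type*) [CommRing R] {ι : Type*} [Fintype ι]
    (S : Set ι → Prop) (F : Finset ι) : MvPolynomial ι R :=
  if S F then ∏ i ∈ Fᶜ, X i else 0

/-- The squarefree polynomial `∑_F ∏_{i ∉ F} t_i`, the sum running over the subsets `F` of a finite
type that satisfy `S`. -/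
noncomputable def subsetPolynomial (R : Type*) [CommRing R] {ι : Type*} [Fintype ι]
    (S : Set ι → Prop) : MvPolynomial ι R :=
  ∑ F : Finset ι, subsetMonomial R S F

variable (R : Type*) [CommRing R] {ι κ : Type*} [Fintype ι] [Fintype κ]

variable {R} in
theorem subsetMonomial_pos [DecidableEq ι] {S : Set ι → Prop} {F : Finset ι} {F' : Set ι}
    (hF : (F : Set ι) = F') (h : S F') : subsetMonomial R S F = ∏ i ∈ Fᶜ, X i := by
  subst hF
  unfold subsetMonomial
  rw [if_pos h]
  congr!

variable {R} in
theorem subsetMonomial_neg {S : Set ι → Prop} {F : Finset ι} {F' : Set ι}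
    (hF : (F : Set ι) = F') (h : ¬ S F') : subsetMonomial R S F = 0 := by
  subst hF
  exact if_neg h

theorem rename_subsetPolynomial (σ : ι ≃ κ) (S : Set ι → Prop) :
    rename σ (subsetPolynomial R S) = subsetPolynomial R fun F => S (σ ⁻¹' F) := by
  classical
  unfold subsetPolynomial
  rw [map_sum]
  refine Fintype.sum_equiv σ.finsetCongr _ _ fun F => ?_
  have h : (σ.finsetCongr F : Set κ) = σ '' F := by simp
  have hσ : σ ⁻¹' (σ '' F) = F := Set.preimage_image_eq _ σ.injective
  have h' : (σ.finsetCongr F)ᶜ = Fᶜ.map σ.toEmbedding := by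
    ext i
    simp [Finset.mem_map_equiv]
  by_cases hS : S F
  · rw [subsetMonomial_pos rfl hS, subsetMonomial_pos h (by rwa [hσ]), h', Finset.prod_map]
    simp [map_prod]
  · rw [subsetMonomial_neg rfl hS, subsetMonomial_neg h (by rwa [hσ]), map_zero]

/-- The expansion of `subsetPolynomial` with respect to one variable. -/
theorem optionEquivLeft_subsetPolynomial (S : Set (Option ι) → Prop) :
    optionEquivLeft R ι (subsetPolynomial R S) =
      Polynomial.X * Polynomial.C (subsetPolynomial R fun F => S (some '' F)) +
        Polynomial.C (subsetPolynomial R fun F => S (insert none (some '' F))) := by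
  classical
  -- Written as the powerset of an `insert`, the index set splits into the subsets without `none`,
  -- whose monomials contain the variable of `none`, and those with it.
  have huniv : (Finset.univ : Finset (Finset (Option ι))) =
      (insert none (Finset.univ.map Function.Embedding.some)).powerset := by
    ext F
    simp only [Finset.mem_univ, Finset.mem_powerset, true_iff]
    rintro (_ | i) _ <;> simp
  have hmap : (Finset.univ.map (Function.Embedding.some (α := ι))).powerset =
      Finset.univ.map (Finset.mapEmbedding Function.Embedding.some).toEmbedding := by
    ext F
    simp only [Finset.mem_powerset, Finset.mem_map, Finset.mem_univ, true_and]
    constructor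
    · intro h
      obtain ⟨F', -, hF'⟩ := Finset.subset_map_iff.1 h
      exact ⟨F', hF'.symm⟩
    · rintro ⟨F', rfl⟩
      exact Finset.map_subset_map.2 (Finset.subset_univ _)
  unfold subsetPolynomial
  rw [huniv, Finset.sum_powerset_insert (by simp), hmap, Finset.sum_map, Finset.sum_map, map_add]
  simp only [map_sum, Finset.mul_sum, RelEmbedding.coe_toEmbedding, Finset.mapEmbedding_apply]
  congr 1
  · refine Finset.sum_congr rfl fun F _ => ?_
    have h : ((F.map Function.Embedding.some : Finset (Option ι)) : Set (Option ι)) =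
        some '' (F : Set ι) := by simp
    have h' : (F.map Function.Embedding.some)ᶜ =
        insert none (Fᶜ.map (Function.Embedding.some (α := ι))) := by
      ext (_ | i) <;> simp
    by_cases hS : S (some '' F)
    · rw [subsetMonomial_pos h hS, subsetMonomial_pos rfl hS, h', Finset.prod_insert (by simp),
        Finset.prod_map]
      simp [map_prod, optionEquivLeft_X_none, optionEquivLeft_X_some]
    · rw [subsetMonomial_neg h hS, subsetMonomial_neg rfl hS]
      simp
  · refine Finset.sum_congr rfl fun F _ => ?_
    have h : ((insert none (F.map Function.Embedding.some) : Finset (Option ι)) :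
        Set (Option ι)) = insert none (some '' (F : Set ι)) := by simp
    have h' : (insert none (F.map Function.Embedding.some))ᶜ =
        Fᶜ.map (Function.Embedding.some (α := ι)) := by
      ext (_ | i) <;> simp
    by_cases hS : S (insert none (some '' F))
    · rw [subsetMonomial_pos h hS, subsetMonomial_pos rfl hS, h', Finset.prod_map]
      simp [map_prod, optionEquivLeft_X_some]
    · rw [subsetMonomial_neg h hS, subsetMonomial_neg rfl hS]
      simp

variable {R} in
theorem subsetPolynomial_congr {S S' : Set ι → Prop} (h : ∀ F, S F ↔ S' F) :
    subsetPolynomial R S = subsetPolynomial R S' := by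
  rw [funext fun F => propext (h F)]

theorem subsetPolynomial_eq_zero {S : Set ι → Prop} (h : ∀ F, ¬ S F) :
    subsetPolynomial R S = 0 :=
  Finset.sum_eq_zero fun _ _ => subsetMonomial_neg rfl (h _)

end SubsetPolynomial

/-! ### The Kirchhoff polynomials of `G` and `G_{2e}` as linear polynomials in one edge variable -/

namespace Graph

open MvPolynomial

variable {α : Type v} {β : Type u} (R : Type u) [CommRing R] (G : Graph α β) [Finite G.edgeSet]

theorem kirchhoffPolynomial_eq [Fintype G.edgeSet] : G.kirchhoffPolynomial R =
    subsetPolynomial R fun F => G.IsSpanningForest (Subtype.val '' F) := by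
  classical
  unfold kirchhoffPolynomial subsetPolynomial subsetMonomial
  rw [← Finset.sum_filter]
  symm
  convert Finset.sum_subtype _ _ _ using 1
  · congr!
  · intro F
    simp

end Graph

namespace Graph

open MvPolynomial

section

variable {α : Type*} {β : Type u} {G : Graph α β} {e : β}

theorem IsLoopingEdge.not_isBridge (he : G.IsLoopingEdge e) : ¬ G.IsBridge e := by
  obtain ⟨x, hx⟩ := he
  rw [isBridge_iff_of_isLink hx, not_not]
  exact .refl ..

/-- The edges of `G` are `e` and the edges of `G ∖ e`. -/
noncomputable def optionEdgeSetEquiv (he : e ∈ G.edgeSet) :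
    Option (G.deleteEdges {e}).edgeSet ≃ G.edgeSet :=
  Equiv.ofBijective (fun f => f.elim ⟨e, he⟩ fun f => ⟨f.1, f.2.1⟩) <| by
    constructor
    · rintro (_ | ⟨f, hf, hfe⟩) (_ | ⟨f', hf', hfe'⟩) h
      · rfl
      · exact absurd (congrArg Subtype.val h).symm hfe'
      · exact absurd (congrArg Subtype.val h) hfe
      · obtain rfl : f = f' := congrArg Subtype.val h
        rfl
    · rintro ⟨f, hf⟩
      by_cases hfe : f = e
      · subst hfe
        exact ⟨none, rfl⟩
      · exact ⟨some ⟨f, hf, hfe⟩, rfl⟩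

/-- The edges of `G_{2e}` are the additional edge and the edges of `G`. -/
noncomputable def optionEdgeSetEquivDoubleEdge (he : e ∈ G.edgeSet) :
    Option G.edgeSet ≃ (G.doubleEdge e).edgeSet :=
  Equiv.ofBijective (fun f => f.elim ⟨none, he⟩ fun f => ⟨some f.1, f.2⟩) <| by
    constructor
    · rintro (_ | ⟨f, hf⟩) (_ | ⟨f', hf'⟩) h
      · rfl
      · cases congrArg Subtype.val h
      · cases congrArg Subtype.val h
      · obtain rfl : f = f' := Option.some_injective _ (congrArg Subtype.val h)
        rfl
    · rintro ⟨_ | f, hf⟩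
      · exact ⟨none, rfl⟩
      · exact ⟨some ⟨f, hf⟩, rfl⟩

theorem coe_image_optionEdgeSetEquiv_some (he : e ∈ G.edgeSet)
    (F : Set (G.deleteEdges {e}).edgeSet) :
    (Subtype.val '' ((optionEdgeSetEquiv he).symm ⁻¹' (some '' F)) : Set β) = Subtype.val '' F := by
  rw [← Equiv.image_eq_preimage_symm, Set.image_image, Set.image_image]
  rfl

theorem coe_image_optionEdgeSetEquiv_insert (he : e ∈ G.edgeSet)
    (F : Set (G.deleteEdges {e}).edgeSet) :
    (Subtype.val '' ((optionEdgeSetEquiv he).symm ⁻¹' (insert none (some '' F))) : Set β) =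
      insert e (Subtype.val '' F) := by
  rw [← Equiv.image_eq_preimage_symm, Set.image_insert_eq, Set.image_insert_eq, Set.image_image,
    Set.image_image]
  rfl

theorem coe_image_optionEdgeSetEquivDoubleEdge_some (he : e ∈ G.edgeSet) (F : Set G.edgeSet) :
    (Subtype.val '' ((optionEdgeSetEquivDoubleEdge he).symm ⁻¹' (some '' F)) : Set (Option β)) =
      some '' (Subtype.val '' F) := by
  rw [← Equiv.image_eq_preimage_symm, Set.image_image, Set.image_image, Set.image_image]
  rfl

theorem coe_image_optionEdgeSetEquivDoubleEdge_insert (he : e ∈ G.edgeSet) (F : Set G.edgeSet) :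
    (Subtype.val '' ((optionEdgeSetEquivDoubleEdge he).symm ⁻¹' (insert none (some '' F))) :
      Set (Option β)) = insert none (some '' (Subtype.val '' F)) := by
  rw [← Equiv.image_eq_preimage_symm, Set.image_insert_eq, Set.image_insert_eq, Set.image_image,
    Set.image_image, Set.image_image]
  rfl

theorem notMem_coe_image_deleteEdges (F : Set (G.deleteEdges {e}).edgeSet) :
    e ∉ (Subtype.val '' F : Set β) := by
  rintro ⟨f, -, hf⟩
  exact f.2.2 hf

end

variable {α : Type v} {β : Type u} (R : Type u) [CommRing R] (G : Graph α β) [Finite G.edgeSet]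
  (e : β)

/-- The sum of the monomials of the spanning forests of `G` that avoid the edge `e`, divided
by `t_e`. -/
noncomputable def kirchhoffAvoiding : MvPolynomial (G.deleteEdges {e}).edgeSet R :=
  letI := Fintype.ofFinite (G.deleteEdges {e}).edgeSet
  subsetPolynomial R fun F => G.IsSpanningForest (Subtype.val '' F)

/-- The sum of the monomials of the spanning forests of `G` that contain the edge `e`. -/
noncomputable def kirchhoffContaining : MvPolynomial (G.deleteEdges {e}).edgeSet R :=
  letI := Fintype.ofFinite (G.deleteEdges {e}).edgeSet
  subsetPolynomial R fun F => G.IsSpanningForest (insert e (Subtype.val '' F))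

/-- The sum of the monomials of the spanning forests of `G` that contain the edge `e`,
multiplied by `t_e`. -/
noncomputable def kirchhoffExchanged : MvPolynomial G.edgeSet R :=
  letI := Fintype.ofFinite G.edgeSet
  subsetPolynomial R fun F =>
    e ∉ (Subtype.val '' F : Set β) ∧ G.IsSpanningForest (insert e (Subtype.val '' F))

variable {e}

/-- The polynomials in the edge variables of `G`, as polynomials in `t_e`. -/
noncomputable def edgePolynomialEquiv (he : e ∈ G.edgeSet) :
    MvPolynomial G.edgeSet R ≃ₐ[R] Polynomial (MvPolynomial (G.deleteEdges {e}).edgeSet R) :=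
  (renameEquiv R (optionEdgeSetEquiv he).symm).trans (optionEquivLeft R _)

theorem edgePolynomialEquiv_kirchhoffPolynomial (he : e ∈ G.edgeSet) :
    edgePolynomialEquiv R G he (G.kirchhoffPolynomial R) =
      Polynomial.X * Polynomial.C (G.kirchhoffAvoiding R e) +
        Polynomial.C (G.kirchhoffContaining R e) := by
  let := Fintype.ofFinite G.edgeSet
  let := Fintype.ofFinite (G.deleteEdges {e}).edgeSet
  rw [kirchhoffPolynomial_eq, edgePolynomialEquiv, AlgEquiv.trans_apply, renameEquiv_apply,
    rename_subsetPolynomial, optionEquivLeft_subsetPolynomial]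
  simp only [coe_image_optionEdgeSetEquiv_some, coe_image_optionEdgeSetEquiv_insert]
  rfl

theorem edgePolynomialEquiv_kirchhoffExchanged (he : e ∈ G.edgeSet) :
    edgePolynomialEquiv R G he (G.kirchhoffExchanged R e) =
      Polynomial.X * Polynomial.C (G.kirchhoffContaining R e) := by
  let := Fintype.ofFinite G.edgeSet
  let := Fintype.ofFinite (G.deleteEdges {e}).edgeSet
  rw [kirchhoffExchanged, edgePolynomialEquiv, AlgEquiv.trans_apply, renameEquiv_apply,
    rename_subsetPolynomial, optionEquivLeft_subsetPolynomial]
  simp only [coe_image_optionEdgeSetEquiv_some, coe_image_optionEdgeSetEquiv_insert]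
  simp only [notMem_coe_image_deleteEdges, Set.mem_insert_iff, true_or, not_true_eq_false,
    not_false_eq_true, true_and, false_and]
  rw [subsetPolynomial_eq_zero (S := fun _ => False) R fun _ => id, map_zero, add_zero]
  rfl

/-- The polynomials in the edge variables of `G_{2e}`, as polynomials in the variable of the
additional edge. -/
noncomputable def doubleEdgePolynomialEquiv (he : e ∈ G.edgeSet) :
    MvPolynomial (G.doubleEdge e).edgeSet R ≃ₐ[R] Polynomial (MvPolynomial G.edgeSet R) :=
  (renameEquiv R (optionEdgeSetEquivDoubleEdge he).symm).trans (optionEquivLeft R _)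

/-- Forests without the additional edge are those of `G`. Forests with it omit the original `e`,
which contributes the factor `t_e`, and become forests of `G` containing `e` once the copies are
identified. -/
theorem doubleEdgePolynomialEquiv_kirchhoffPolynomial (he : e ∈ G.edgeSet) :
    doubleEdgePolynomialEquiv R G he ((G.doubleEdge e).kirchhoffPolynomial R) =
      Polynomial.X * Polynomial.C (G.kirchhoffPolynomial R) +
        Polynomial.C (G.kirchhoffExchanged R e) := by
  let := Fintype.ofFinite G.edgeSet
  let := Fintype.ofFinite (G.doubleEdge e).edgeSet
  rw [kirchhoffPolynomial_eq, doubleEdgePolynomialEquiv, AlgEquiv.trans_apply, renameEquiv_apply,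
    rename_subsetPolynomial, optionEquivLeft_subsetPolynomial, kirchhoffPolynomial_eq]
  simp only [coe_image_optionEdgeSetEquivDoubleEdge_some,
    coe_image_optionEdgeSetEquivDoubleEdge_insert, isSpanningForest_doubleEdge he,
    Set.image_insert_eq, Set.image_image, Option.getD_some, Option.getD_none]
  congr 2
  · congr 1
    refine subsetPolynomial_congr fun F => and_iff_right ?_
    simp
  · refine subsetPolynomial_congr fun F => and_congr_left fun _ => not_congr ?_
    simp

theorem kirchhoffAvoiding_of_not_isBridge (he : e ∈ G.edgeSet) (hb : ¬ G.IsBridge e) :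
    G.kirchhoffAvoiding R e = (G.deleteEdges {e}).kirchhoffPolynomial R := by
  let := Fintype.ofFinite (G.deleteEdges {e}).edgeSet
  rw [kirchhoffPolynomial_eq]
  exact subsetPolynomial_congr fun F =>
    (isSpanningForest_deleteEdges_of_not_isBridge he hb (notMem_coe_image_deleteEdges F)).symm

theorem kirchhoffAvoiding_of_isBridge (hb : G.IsBridge e) : G.kirchhoffAvoiding R e = 0 :=
  letI := Fintype.ofFinite (G.deleteEdges {e}).edgeSet
  subsetPolynomial_eq_zero R fun F h =>
    notMem_coe_image_deleteEdges F (hb.mem_of_isSpanningForest h)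

theorem kirchhoffContaining_of_isBridge (hb : G.IsBridge e) :
    G.kirchhoffContaining R e = (G.deleteEdges {e}).kirchhoffPolynomial R := by
  let := Fintype.ofFinite (G.deleteEdges {e}).edgeSet
  rw [kirchhoffPolynomial_eq]
  exact subsetPolynomial_congr fun F =>
    (isSpanningForest_deleteEdges_of_isBridge hb (notMem_coe_image_deleteEdges F)).symm

theorem kirchhoffContaining_of_isLoopingEdge (hl : G.IsLoopingEdge e) :
    G.kirchhoffContaining R e = 0 :=
  letI := Fintype.ofFinite (G.deleteEdges {e}).edgeSet
  subsetPolynomial_eq_zero R fun _ h =>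
    hl.notMem_of_isSpanningForest h (Set.mem_insert ..)

theorem kirchhoffContaining_of_not_isLoopingEdge (he : e ∈ G.edgeSet)
    (hl : ¬ G.IsLoopingEdge e) :
    G.kirchhoffContaining R e = (G.contractEdge e).kirchhoffPolynomial R := by
  let := Fintype.ofFinite (G.deleteEdges {e}).edgeSet
  -- Contraction and deletion of `e` have definitionally the same edge set, so both polynomials live
  -- in the same ring.
  let : Fintype (G.contractEdge e).edgeSet := this
  rw [kirchhoffPolynomial_eq]
  exact subsetPolynomial_congr fun F =>
    (isSpanningForest_contractEdge he hl (notMem_coe_image_deleteEdges F)).symm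

end Graph

/-! ### Locally closed pieces of affine schemes, by universal property -/

/-- The algebra `W` represents the locally closed subset of `Spec A` on which `h` vanishes and `g`
is invertible. -/
structure IsPiece {k A W : Type u} [CommRing k] [CommRing A] [CommRing W] [Algebra k A]
    [Algebra k W] (f : A →ₐ[k] W) (h g : A) : Prop where
  map_eq_zero : f h = 0
  isUnit_map : IsUnit (f g)
  exists_lift : ∀ {Z : Type u} [CommRing Z] [Algebra k Z] (φ : A →ₐ[k] Z), φ h = 0 →
    IsUnit (φ g) → ∃ ψ : W →ₐ[k] Z, ψ.comp f = φ
  hom_ext : ∀ {Z : Type u} [CommRing Z] [Algebra k Z] (ψ ψ' : W →ₐ[k] Z),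
    ψ.comp f = ψ'.comp f → ψ = ψ'

namespace IsPiece

variable {k A B W V : Type u} [CommRing k] [CommRing A] [CommRing B] [CommRing W] [CommRing V]
  [Algebra k A] [Algebra k B] [Algebra k W] [Algebra k V] {f : A →ₐ[k] W} {h h' g g' : A}

theorem nonempty_algEquiv {f' : A →ₐ[k] V} (hf : IsPiece f h g) (hf' : IsPiece f' h g) :
    Nonempty (W ≃ₐ[k] V) := by
  obtain ⟨ψ, hψ⟩ := hf.exists_lift f' hf'.map_eq_zero hf'.isUnit_map
  obtain ⟨ψ', hψ'⟩ := hf'.exists_lift f hf.map_eq_zero hf.isUnit_map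
  refine ⟨AlgEquiv.ofAlgHom ψ ψ' (hf'.hom_ext _ _ ?_) (hf.hom_ext _ _ ?_)⟩
  · rw [AlgHom.comp_assoc, hψ', hψ, AlgHom.id_comp]
  · rw [AlgHom.comp_assoc, hψ, hψ', AlgHom.id_comp]

theorem of_isLocalization [Algebra A W] [IsScalarTower k A W] [IsLocalization.Away g W] :
    IsPiece (IsScalarTower.toAlgHom k A W) 0 g where
  map_eq_zero := map_zero _
  isUnit_map := IsLocalization.Away.algebraMap_isUnit g
  exists_lift φ _ hg := by
    refine ⟨IsLocalization.liftAlgHom (M := Submonoid.powers g) (f := φ) ?_, ?_⟩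
    · rintro ⟨-, n, rfl⟩
      rw [map_pow]
      exact hg.pow n
    · ext a
      simp
  hom_ext ψ ψ' hψ := by
    have := IsLocalization.ringHom_ext (Submonoid.powers g) (j := ψ.toRingHom)
      (k := ψ'.toRingHom) (RingHom.ext fun a => DFunLike.congr_fun hψ a)
    exact AlgHom.ext fun w => DFunLike.congr_fun this w

theorem of_quotient : IsPiece (Ideal.Quotient.mkₐ k (Ideal.span {h})) h 1 where
  map_eq_zero := Ideal.Quotient.eq_zero_iff_mem.2 (Ideal.mem_span_singleton_self h)
  isUnit_map := by
    rw [map_one]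
    exact isUnit_one
  exists_lift φ hh _ := by
    refine ⟨Ideal.Quotient.liftₐ _ φ fun a ha => ?_, ?_⟩
    · obtain ⟨b, rfl⟩ := Ideal.mem_span_singleton.1 ha
      rw [map_mul, hh, zero_mul]
    · rfl
  hom_ext ψ ψ' hψ := Ideal.Quotient.algHom_ext _ hψ

/-- The divisibilities make `h₁ = h + h'` generate the ideal `(h, h')`, so a single equation still
describes the intersection; in the applications `h` or `h'` is `0`. -/
theorem comp {f' : W →ₐ[k] V} {h₁ g₁ : A} (hf : IsPiece f h g) (hf' : IsPiece f' (f h') (f g'))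
    (e : h₁ = h + h') (d : h₁ ∣ h) (d' : h₁ ∣ h') (eg : g₁ = g * g') :
    IsPiece (f'.comp f) h₁ g₁ where
  map_eq_zero := by
    rw [AlgHom.comp_apply, e, map_add, map_add, hf.map_eq_zero, hf'.map_eq_zero, map_zero, zero_add]
  isUnit_map := by
    rw [AlgHom.comp_apply, eg, map_mul, map_mul]
    exact (hf.isUnit_map.map f').mul hf'.isUnit_map
  exists_lift φ hh hg := by
    rw [eg, map_mul, IsUnit.mul_iff] at hg
    obtain ⟨ψ, rfl⟩ := hf.exists_lift φ (zero_dvd_iff.1 (hh ▸ map_dvd φ d)) hg.1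
    obtain ⟨ψ', rfl⟩ := hf'.exists_lift ψ (zero_dvd_iff.1 (hh ▸ map_dvd (ψ.comp f) d')) hg.2
    exact ⟨ψ', (AlgHom.comp_assoc ..).symm⟩
  hom_ext ψ ψ' hψ := hf'.hom_ext _ _ (hf.hom_ext _ _ (by simpa only [AlgHom.comp_assoc] using hψ))

theorem comp_algEquiv {f : B →ₐ[k] W} (e : A ≃ₐ[k] B) (hf : IsPiece f (e h) (e g)) :
    IsPiece (f.comp e.toAlgHom) h g where
  map_eq_zero := hf.map_eq_zero
  isUnit_map := hf.isUnit_map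
  exists_lift φ hh hg := by
    obtain ⟨ψ, hψ⟩ := hf.exists_lift (φ.comp e.symm.toAlgHom) (by simpa) (by simpa)
    refine ⟨ψ, ?_⟩
    rw [← AlgHom.comp_assoc, hψ]
    ext a
    simp
  hom_ext ψ ψ' hψ := by
    refine hf.hom_ext _ _ (AlgHom.ext fun b => ?_)
    simpa using DFunLike.congr_fun hψ (e.symm b)

theorem congr_right (hf : IsPiece f h g) (hgg : h ∣ g - g') : IsPiece f h g' where
  map_eq_zero := hf.map_eq_zero
  isUnit_map := by
    have h1 := map_dvd f hgg
    rw [hf.map_eq_zero, zero_dvd_iff, map_sub, sub_eq_zero] at h1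
    exact h1 ▸ hf.isUnit_map
  exists_lift φ hh hg := by
    have h1 := map_dvd φ hgg
    rw [hh, zero_dvd_iff, map_sub, sub_eq_zero] at h1
    exact hf.exists_lift φ hh (h1 ▸ hg)
  hom_ext := hf.hom_ext

open Polynomial

theorem mapAlgHom (hf : IsPiece f h g) : IsPiece (Polynomial.mapAlgHom f) (C h) (C g) where
  map_eq_zero := by simp [hf.map_eq_zero]
  isUnit_map := by simpa using hf.isUnit_map
  exists_lift φ hh hg := by
    obtain ⟨ψ, hψ⟩ := hf.exists_lift (φ.comp CAlgHom) hh hg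
    refine ⟨eval₂AlgHom ψ (φ X) fun _ => .all _ _, algHom_ext' (AlgHom.ext fun a => ?_) ?_⟩
    · simpa using DFunLike.congr_fun hψ a
    · simp
  hom_ext ψ ψ' hψ := by
    refine algHom_ext' (hf.hom_ext _ _ (AlgHom.ext fun a => ?_)) ?_
    · simpa using DFunLike.congr_fun hψ (C a)
    · simpa using DFunLike.congr_fun hψ X

/-- The subset of the affine line over `Spec A` cut out by `X D + C = 0` is the graph of a function
where `D` is invertible. -/
theorem polynomialEval {p q d : A} {s : A[X]} {w : W} (hf : IsPiece f 0 d) (hw : w * f p + f q = 0)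
    (hp : IsUnit (f p)) (hs : IsUnit (eval₂ (f : A →+* W) w s))
    (hd : ∀ {Z : Type u} [CommRing Z] [Algebra k Z] (φ : A[X] →ₐ[k] Z),
      φ (X * C p + C q) = 0 → IsUnit (φ s) → IsUnit (φ (C d))) :
    IsPiece (Polynomial.eval₂AlgHom f w fun _ => .all _ _) (X * C p + C q) s where
  map_eq_zero := by simpa [mul_comm (f p)] using hw
  isUnit_map := hs
  exists_lift φ hh hg := by
    obtain ⟨ψ, hψ⟩ := hf.exists_lift (φ.comp CAlgHom) (map_zero _) (hd φ hh hg)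
    have hψ' : ∀ a, ψ (f a) = φ (C a) := DFunLike.congr_fun hψ
    refine ⟨ψ, algHom_ext' (AlgHom.ext fun a => ?_) ?_⟩
    · simpa using hψ' a
    · have h1 : ψ w * φ (C p) + φ (C q) = 0 := by
        rw [← hψ', ← hψ', ← map_mul, ← map_add, hw, map_zero]
      rw [map_add, map_mul] at hh
      have h2 : IsUnit (φ (C p)) := hψ' p ▸ hp.map ψ
      have h3 : ψ w = φ X := h2.mul_right_cancel (add_right_cancel (h1.trans hh.symm))
      simpa using h3
  hom_ext ψ ψ' hψ := by
    refine hf.hom_ext _ _ (AlgHom.ext fun a => ?_)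
    simpa using DFunLike.congr_fun hψ (C a)

end IsPiece

/-! ### Classes of affine varieties in the Grothendieck ring -/

section AffineClass

variable (k : Type u) [Field k]

/-- The class of `Spec A` in the Grothendieck ring of varieties. -/
noncomputable def affineClass (A : Type u) [CommRing A] [Algebra k A] [Algebra.FiniteType k A] :
    GrothendieckRing k :=
  (AlgVariety.affine k A).cls

theorem torusClass_eq : torusClass k = affineClass k (LaurentPolynomial k) :=
  rfl

variable {k}

namespace AlgVariety

theorem cls_eq_of_iso {X Y : AlgVariety k} (f : X.carrier ≅ Y.carrier)
    (hf : f.hom ≫ Y.str = X.str) : X.cls = Y.cls :=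
  Ideal.Quotient.eq.2 (Ideal.subset_span (.iso X Y f hf))

theorem cls_eq_add {X Z U : AlgVariety k} (i : Z.carrier ⟶ X.carrier) (j : U.carrier ⟶ X.carrier)
    (hi : IsClosedImmersion i) (hj : IsOpenImmersion j) (hiX : i ≫ X.str = Z.str)
    (hjX : j ≫ X.str = U.str) (hij : Set.range j = (Set.range i)ᶜ) : X.cls = Z.cls + U.cls :=
  Ideal.Quotient.eq.2 (Ideal.subset_span (.scissors X Z U i j hi hj hiX hjX hij))

theorem cls_eq_mul {X Y P : AlgVariety k} (p : P.carrier ⟶ X.carrier) (q : P.carrier ⟶ Y.carrier)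
    (h : IsPullback p q X.str Y.str) (hp : p ≫ X.str = P.str) : P.cls = X.cls * Y.cls :=
  Ideal.Quotient.eq.2 (Ideal.subset_span (.prod X Y P p q h hp))

end AlgVariety

variable {A B : Type u} [CommRing A] [CommRing B] [Algebra k A] [Algebra k B]
  [Algebra.FiniteType k A] [Algebra.FiniteType k B]

theorem specMap_comp_affine_str (f : A →ₐ[k] B) :
    Spec.map (CommRingCat.ofHom f.toRingHom) ≫ (AlgVariety.affine k A).str =
      (AlgVariety.affine k B).str := by
  change Spec.map _ ≫ Spec.map _ = Spec.map _
  rw [← Spec.map_comp, ← CommRingCat.ofHom_comp]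
  congr 2
  exact f.comp_algebraMap

theorem affineClass_self : affineClass k k = 1 :=
  Ideal.Quotient.eq.2 (Ideal.subset_span .one)

theorem affineClass_congr (e : A ≃ₐ[k] B) : affineClass k A = affineClass k B := by
  refine AlgVariety.cls_eq_of_iso (Scheme.Spec.mapIso e.symm.toRingEquiv.toCommRingCatIso.op) ?_
  exact specMap_comp_affine_str e.symm.toAlgHom

theorem affineClass_tensorProduct [Algebra.FiniteType k (TensorProduct k A B)] :
    affineClass k (TensorProduct k A B) = affineClass k A * affineClass k B := by
  refine AlgVariety.cls_eq_mul (X := .affine k A) (Y := .affine k B)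
    (P := .affine k (TensorProduct k A B)) _ _
    (isPullback_SpecMap_of_isPushout _ _ _ _ (CommRingCat.isPushout_tensorProduct k A B)) ?_
  exact specMap_comp_affine_str (Algebra.TensorProduct.includeLeft : A →ₐ[k] TensorProduct k A B)

theorem affineClass_eq_add (h : A) : affineClass k A =
    affineClass k (A ⧸ Ideal.span {h}) + affineClass k (Localization.Away h) := by
  refine AlgVariety.cls_eq_add
    (Spec.map (CommRingCat.ofHom (Ideal.Quotient.mkₐ k (Ideal.span {h})).toRingHom))
    (Spec.map (CommRingCat.ofHom (algebraMap A (Localization.Away h))))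
    (IsClosedImmersion.spec_of_surjective _ Ideal.Quotient.mk_surjective)
    (Scheme.isOpenImmersion_SpecMap_localizationAway (R := .of A) h)
    (specMap_comp_affine_str _)
    (specMap_comp_affine_str (IsScalarTower.toAlgHom k A (Localization.Away h))) ?_
  refine (PrimeSpectrum.localization_away_comap_range (Localization.Away h) h).trans ?_
  rw [PrimeSpectrum.basicOpen_eq_zeroLocus_compl]
  congr 1
  refine Eq.trans ?_ (range_comap_of_surjective _ _ Ideal.Quotient.mk_surjective).symm
  rw [Ideal.mk_ker, PrimeSpectrum.zeroLocus_span]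

/-- Cutting the empty scheme along `0` gives two copies of itself, so its class satisfies `x = x +
x`. -/
theorem affineClass_of_subsingleton [Subsingleton A] : affineClass k A = 0 := by
  have h1 := affineClass_eq_add (k := k) (0 : A)
  have : Subsingleton (Localization.Away (0 : A)) := IsLocalization.subsingleton
    (M := Submonoid.powers (0 : A)) (Submonoid.mem_powers 0)
  have e1 : A ≃ₐ[k] A ⧸ Ideal.span {(0 : A)} :=
    AlgEquiv.ofBijective (Ideal.Quotient.mkₐ k _)
      ⟨fun _ _ _ => Subsingleton.elim _ _, Ideal.Quotient.mk_surjective⟩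
  have e2 : A ≃ₐ[k] Localization.Away (0 : A) :=
    AlgEquiv.ofBijective (IsScalarTower.toAlgHom k A _)
      ⟨fun _ _ _ => Subsingleton.elim _ _, fun x => ⟨0, Subsingleton.elim _ _⟩⟩
  rw [← affineClass_congr e1, ← affineClass_congr e2] at h1
  exact left_eq_add.1 h1

theorem affineClass_polynomial :
    affineClass k (Polynomial A) = affineClass k (Polynomial k) * affineClass k A := by
  have : Algebra.FiniteType k (TensorProduct k A (Polynomial k)) :=
    .equiv inferInstance (polyEquivTensor k A)
  rw [affineClass_congr (polyEquivTensor k A), affineClass_tensorProduct, mul_comm]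

/-- The affine line is cut into the origin and its complement `𝔾_m`. -/
theorem affineClass_polynomial_self : affineClass k (Polynomial k) = torusClass k + 1 := by
  have : IsScalarTower k (Polynomial k) (LaurentPolynomial k) :=
    .of_algebraMap_eq' (Polynomial.toLaurentAlg (R := k)).comp_algebraMap.symm
  have e1 : (Polynomial k ⧸ Ideal.span {(Polynomial.X : Polynomial k)}) ≃ₐ[k] k :=
    (Ideal.quotientEquivAlgOfEq k (by simp)).trans (Polynomial.quotientSpanXSubCAlgEquiv (0 : k))
  have e2 : Localization.Away (Polynomial.X : Polynomial k) ≃ₐ[k] LaurentPolynomial k :=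
    (IsLocalization.algEquiv (Submonoid.powers (Polynomial.X : Polynomial k)) _ _).restrictScalars k
  rw [affineClass_eq_add (Polynomial.X : Polynomial k), affineClass_congr e1, affineClass_congr e2,
    affineClass_self, add_comm, torusClass_eq]

/-- The open subscheme and the spectrum of the localization are open immersions into affine space
with the same range. From here on only affine schemes are needed. -/
theorem cls_hypersurfaceComplement {ι : Type u} [Finite ι] (Ψ : MvPolynomial ι k) :
    (hypersurfaceComplement Ψ).cls = affineClass k (Localization.Away Ψ) := by
  let j : Spec (CommRingCat.of (Localization.Away Ψ)) ⟶ (affineSpaceVariety k ι).carrier :=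
    Spec.map (CommRingCat.ofHom (algebraMap (MvPolynomial ι k) (Localization.Away Ψ)))
  have hj : IsOpenImmersion j :=
    Scheme.isOpenImmersion_SpecMap_localizationAway (R := .of (MvPolynomial ι k)) Ψ
  let U : (affineSpaceVariety k ι).carrier.Opens :=
    ⟨(PrimeSpectrum.zeroLocus {Ψ})ᶜ, (PrimeSpectrum.isClosed_zeroLocus {Ψ}).isOpen_compl⟩
  have hU : IsOpenImmersion U.ι := inferInstance
  have hr : Set.range U.ι = Set.range j := by
    rw [Scheme.Opens.range_ι]
    refine Eq.symm ?_
    refine (PrimeSpectrum.localization_away_comap_range (Localization.Away Ψ) Ψ).trans ?_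
    exact PrimeSpectrum.basicOpen_eq_zeroLocus_compl Ψ
  let i := IsOpenImmersion.isoOfRangeEq U.ι j hr
  have hi : i.hom ≫ j = U.ι := IsOpenImmersion.isoOfRangeEq_hom_fac U.ι j hr
  refine AlgVariety.cls_eq_of_iso i ?_
  have hs : j ≫ (affineSpaceVariety k ι).str =
      (AlgVariety.affine k (Localization.Away Ψ)).str :=
    specMap_comp_affine_str (IsScalarTower.toAlgHom k (MvPolynomial ι k) (Localization.Away Ψ))
  rw [← hs]
  exact (Category.assoc _ _ _).symm.trans (congrArg (· ≫ (affineSpaceVariety k ι).str) hi)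

end AffineClass

/-! ### Classes of locally closed pieces and the cutting of a line bundle by a linear equation -/

section PieceClass

variable (k : Type u) [Field k] {A B W : Type u} [CommRing A] [CommRing B] [CommRing W]
  [Algebra k A] [Algebra k B] [Algebra k W]

/-- The projection of an algebra onto the functions on the locally closed subset on which `h`
vanishes and `g` is invertible. -/
noncomputable def toPiece (h g : A) :
    A →ₐ[k] Localization.Away (Ideal.Quotient.mk (Ideal.span {h}) g) :=
  (IsScalarTower.toAlgHom k (A ⧸ Ideal.span {h}) _).comp (Ideal.Quotient.mkₐ k (Ideal.span {h}))

theorem isPiece_toPiece (h g : A) : IsPiece (toPiece k h g) h g := by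
  refine IsPiece.comp (h' := 0) (g' := g) .of_quotient ?_ (add_zero h).symm dvd_rfl (dvd_zero h)
    (one_mul g).symm
  rw [map_zero]
  exact .of_isLocalization (g := Ideal.Quotient.mk (Ideal.span {h}) g)

variable [Algebra.FiniteType k A] [Algebra.FiniteType k B] [Algebra.FiniteType k W]

/-- The class of the locally closed subset of `Spec A` on which `h` vanishes and `g` is
invertible. -/
noncomputable def pieceClass (h g : A) : GrothendieckRing k :=
  affineClass k (Localization.Away (Ideal.Quotient.mk (Ideal.span {h}) g))

variable {k}

theorem IsPiece.pieceClass_eq {f : A →ₐ[k] W} {h g : A} (hf : IsPiece f h g) :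
    pieceClass k h g = affineClass k W :=
  affineClass_congr ((isPiece_toPiece k h g).nonempty_algEquiv hf).some

theorem pieceClass_algEquiv (e : A ≃ₐ[k] B) (h g : A) :
    pieceClass k (e h) (e g) = pieceClass k h g :=
  ((isPiece_toPiece k (e h) (e g)).comp_algEquiv e).pieceClass_eq.symm

theorem pieceClass_zero_left (g : A) : pieceClass k 0 g = affineClass k (Localization.Away g) :=
  IsPiece.of_isLocalization.pieceClass_eq

theorem pieceClass_zero_right (h : A) : pieceClass k h 0 = 0 := by
  have : Subsingleton (Localization.Away (Ideal.Quotient.mk (Ideal.span {h}) 0)) := by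
    rw [map_zero]
    exact IsLocalization.subsingleton
      (M := Submonoid.powers (0 : A ⧸ Ideal.span {h})) (Submonoid.mem_powers _)
  exact affineClass_of_subsingleton

/-- A principal open subset is cut into two pieces by a further function. -/
theorem pieceClass_eq_add (g h : A) :
    pieceClass k 0 g = pieceClass k 0 (g * h) + pieceClass k h g := by
  have hg : IsPiece (IsScalarTower.toAlgHom k A (Localization.Away g)) 0 g := .of_isLocalization
  have h1 : IsPiece ((IsScalarTower.toAlgHom k (Localization.Away g)
      (Localization.Away (algebraMap A (Localization.Away g) h))).comp
        (IsScalarTower.toAlgHom k A (Localization.Away g))) 0 (g * h) := by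
    refine hg.comp (h' := 0) (g' := h) ?_ (add_zero 0).symm dvd_rfl dvd_rfl rfl
    rw [map_zero]
    exact .of_isLocalization (g := algebraMap A (Localization.Away g) h)
  have h2 : IsPiece ((Ideal.Quotient.mkₐ k (Ideal.span {algebraMap A (Localization.Away g) h})).comp
        (IsScalarTower.toAlgHom k A (Localization.Away g))) h g := by
    refine hg.comp (h' := h) (g' := 1) ?_ (zero_add h).symm (dvd_zero h) dvd_rfl (mul_one g).symm
    rw [map_one]
    exact .of_quotient
  rw [h1.pieceClass_eq, h2.pieceClass_eq, hg.pieceClass_eq,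
    affineClass_eq_add (algebraMap A (Localization.Away g) h), add_comm]

open Polynomial

theorem pieceClass_C (h g : A) :
    pieceClass k (C h) (C g) = (torusClass k + 1) * pieceClass k h g := by
  rw [(isPiece_toPiece k h g).mapAlgHom.pieceClass_eq, affineClass_polynomial,
    affineClass_polynomial_self]
  rfl

/-- The graph of the solution `t = -q / p` of `t p + q = 0` over the locus where `p` is
invertible. -/
theorem pieceClass_graph (p q : A) :
    pieceClass k (X * C p + C q) (C p) = pieceClass k 0 p := by
  have hf := isPiece_toPiece k 0 p
  obtain ⟨r, hr⟩ := hf.isUnit_map.exists_left_inv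
  refine (hf.polynomialEval (p := p) (q := q) (s := C p) (w := -(r * toPiece k 0 p q)) ?_
    hf.isUnit_map ?_ fun _ _ => id).pieceClass_eq
  · linear_combination (- toPiece k 0 p q) * hr
  · simpa using hf.isUnit_map

/-- Where `t p + q = 0` with `t` and `q` invertible, `p` is invertible as well; conversely, where `p
q` is invertible, `t = -q / p` is a unit. The projection to the base is thus an isomorphism onto `p
q ≠ 0`. -/
theorem pieceClass_graph_mul (p q : A) :
    pieceClass k (X * C p + C q) (X * C q) = pieceClass k 0 (p * q) := by
  have hf := isPiece_toPiece k 0 (p * q)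
  have hu := IsUnit.mul_iff.1 (map_mul (toPiece k 0 (p * q)) p q ▸ hf.isUnit_map)
  obtain ⟨r, hr⟩ := hu.1.exists_left_inv
  have hr' : IsUnit r := .of_mul_eq_one _ hr
  refine (hf.polynomialEval (p := p) (q := q) (s := X * C q)
    (w := -(r * toPiece k 0 (p * q) q)) ?_ hu.1 ?_ fun φ hφ hs => ?_).pieceClass_eq
  · linear_combination (- toPiece k 0 (p * q) q) * hr
  · simp [hr', hu.2]
  · rw [map_mul, IsUnit.mul_iff] at hs
    rw [map_add, map_mul, add_eq_zero_iff_eq_neg] at hφ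
    -- Now `φ (-q) = φ (t p)` is a unit, so its factor `φ p` is one too.
    have := hs.2.neg
    rw [← hφ, IsUnit.mul_iff] at this
    rw [map_mul, map_mul]
    exact this.2.mul hs.2

/-- The complement of `t p + q = 0` in the affine line over `Spec A`: a line minus a point where `p`
is invertible, and a line where `p` vanishes and `q` is invertible. -/
theorem pieceClass_linear (p q : A) : pieceClass k 0 (X * C p + C q) =
    torusClass k * pieceClass k 0 p + (torusClass k + 1) * pieceClass k p q := by
  -- The locus where both `p` and `t p + q` are invertible is computed twice: inside the complement
  -- of `t p + q = 0`, and inside the line over `p ≠ 0`, where what is left is a graph. Subtraction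
  -- eliminates it.
  have h1 := pieceClass_eq_add (k := k) (X * C p + C q) (C p)
  have h2 := pieceClass_eq_add (k := k) (C p) (X * C p + C q)
  have h3 : pieceClass k (C p) (X * C p + C q) = (torusClass k + 1) * pieceClass k p q := by
    rw [← pieceClass_C]
    -- Modulo `p`, the function `t p + q` is just `q`.
    exact (((isPiece_toPiece k p q).mapAlgHom.congr_right (g' := X * C p + C q)
      ⟨-X, by ring⟩).pieceClass_eq).trans (isPiece_toPiece k p q).mapAlgHom.pieceClass_eq.symm
  have h4 := pieceClass_C (k := k) 0 p
  rw [map_zero] at h4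
  rw [pieceClass_graph, h4, mul_comm (C p)] at h2
  rw [h3] at h1
  linear_combination h1 - h2

end PieceClass

/-! ### The motivic Feynman rule and the doubling formula -/

section FeynmanRule

open Graph

variable (k : Type u) [Field k] {α : Type v} {β : Type u} (G : Graph α β) [Finite G.edgeSet]
  {e : β}

theorem motivicFeynmanRule_eq :
    motivicFeynmanRule k G = pieceClass k 0 (G.kirchhoffPolynomial k) := by
  rw [pieceClass_zero_left]
  exact cls_hypersurfaceComplement _

theorem motivicFeynmanRule_eq_linear (he : e ∈ G.edgeSet) : motivicFeynmanRule k G =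
    torusClass k * pieceClass k 0 (G.kirchhoffAvoiding k e) +
      (torusClass k + 1) *
        pieceClass k (G.kirchhoffAvoiding k e) (G.kirchhoffContaining k e) := by
  rw [motivicFeynmanRule_eq, ← pieceClass_algEquiv (edgePolynomialEquiv k G he), map_zero,
    edgePolynomialEquiv_kirchhoffPolynomial, pieceClass_linear]

theorem motivicFeynmanRule_doubleEdge (he : e ∈ G.edgeSet) :
    motivicFeynmanRule k (G.doubleEdge e) = torusClass k * motivicFeynmanRule k G +
      (torusClass k + 1) *
        pieceClass k 0 (G.kirchhoffAvoiding k e * G.kirchhoffContaining k e) := by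
  rw [motivicFeynmanRule_eq, ← pieceClass_algEquiv (doubleEdgePolynomialEquiv k G he), map_zero,
    doubleEdgePolynomialEquiv_kirchhoffPolynomial, pieceClass_linear, ← motivicFeynmanRule_eq,
    ← pieceClass_algEquiv (edgePolynomialEquiv k G he) (G.kirchhoffPolynomial k),
    edgePolynomialEquiv_kirchhoffPolynomial, edgePolynomialEquiv_kirchhoffExchanged,
    pieceClass_graph_mul]

end FeynmanRule

theorem proposition5p2 (k : Type u) [Field k] {α : Type v} {β : Type u}
    (G : Graph α β) [Finite G.vertexSet] [Finite G.edgeSet] (e : β) (he : e ∈ G.edgeSet) :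
    (G.IsLoopingEdge e →
      motivicFeynmanRule k (G.doubleEdge e) =
        torusClass k ^ 2 * motivicFeynmanRule k (G.deleteEdges {e})) ∧
    (G.IsBridge e →
      motivicFeynmanRule k (G.doubleEdge e) =
        torusClass k * (torusClass k + 1) * motivicFeynmanRule k (G.deleteEdges {e})) ∧
    (¬ G.IsLoopingEdge e → ¬ G.IsBridge e →
      motivicFeynmanRule k (G.doubleEdge e) =
        (torusClass k - 1) * motivicFeynmanRule k G +
          torusClass k * motivicFeynmanRule k (G.deleteEdges {e}) +
          (torusClass k + 1) * motivicFeynmanRule k (G.contractEdge e)) := by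
  rw [motivicFeynmanRule_doubleEdge k G he]
  refine ⟨fun hl => ?_, fun hb => ?_, fun hl hb => ?_⟩
  · rw [motivicFeynmanRule_eq_linear k G he, motivicFeynmanRule_eq k (G.deleteEdges {e}),
      G.kirchhoffContaining_of_isLoopingEdge k hl,
      G.kirchhoffAvoiding_of_not_isBridge k he hl.not_isBridge, mul_zero, pieceClass_zero_right,
      pieceClass_zero_right]
    ring
  · rw [motivicFeynmanRule_eq_linear k G he, motivicFeynmanRule_eq k (G.deleteEdges {e}),
      G.kirchhoffContaining_of_isBridge k hb, G.kirchhoffAvoiding_of_isBridge k hb, zero_mul,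
      pieceClass_zero_right]
    ring
  · have h1 := motivicFeynmanRule_eq_linear k G he
    have h2 : motivicFeynmanRule k (G.contractEdge e) =
        pieceClass k 0 (G.kirchhoffContaining k e) := by
      rw [G.kirchhoffContaining_of_not_isLoopingEdge k he hl]
      exact motivicFeynmanRule_eq k (G.contractEdge e)
    -- Cutting `C ≠ 0` along `A = 0` expresses `[A C ≠ 0]` through `[C ≠ 0]` and the class `[A = 0,
    -- C ≠ 0]`, which also occurs in `h1` with coefficient `𝕋 + 1` and so cancels.
    have h3 := pieceClass_eq_add (k := k) (G.kirchhoffContaining k e) (G.kirchhoffAvoiding k e)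
    rw [mul_comm] at h3
    rw [h2, motivicFeynmanRule_eq k (G.deleteEdges {e}),
      ← G.kirchhoffAvoiding_of_not_isBridge k he hb]
    linear_combination h1 - (torusClass k + 1) * h3
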